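/- Let $n\ge 1$. A body in $\mathbb R^n$ is a compact convex set with non-empty interior. Let $C\subset\mathbb R^n$ be a body with $C=-C$ and let $K\subset\mathbb R^n$ be a body. For $u\in\mathbb R^n\setminus\{0\}$ put $$b_u(K,C)=\frac{\max_{x,y\in K}u^T(x-y)}{\max_{x\in C}u^Tx},\qquad w(K,C)=\min_{u\ne 0}b_u(K,C),\qquad D(K,C)=\max_{u\neq 0}b_u(K,C),$$ and let $$R(K,C)=\inf\{\rho>0: K\subset \rho C+t \text{ for some } t\in\mathbb R^n\},\qquad r(K,C)=\sup\{\rho>0: \rho C\subset K+t\text{ for some } t\in\mathbb R^n\},$$ $$s(K)=\inf\{\rho>0: K-c\subset\rho(c-K)\text{ for some } c\in\mathbb R^n\}.$$ Call $K$ pseudo-complete with respect to $C$ if $r(K,C)+R(K,C)=D(K,C)$, and complete with respect to $C$ if every proper superset of $K$ has a greater diameter with respect to $C$ than $K$ (the diameter of an arbitrary set being the supremum of its breadths $b_u$, with maxima replaced by suprema; it is infinite for unbounded sets). (1) If $K$ is pseudo-complete with respect to $C$, then $$\frac{D(K,C)}{w(K,C)}\le\frac{s(K)+1}{2}.$$ (2)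 If $n>2$ is odd and $s\in[1,n]$, or if $n>2$ is even and $s\in[1,n-1]$, then there exist a body $K\subset\mathbb R^n$ and a body $C=-C\subset\mathbb R^n$ such that $K$ is complete with respect to $C$, $s(K)=s$ and $$\frac{D(K,C)}{w(K,C)}=\frac{s+1}{2}.$$ -/

import Mathlib

open scoped Pointwise

noncomputable section

/-- A (convex) body of `ℝⁿ`: a full-dimensional compact convex set. -/
structure IsBody {n : ℕ} (K : Set (EuclideanSpace ℝ (Fin n))) : Prop where
  convex : Convex ℝ K
  isCompact : IsCompact K
  interior_nonempty : (interior K).Nonempty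

/-- A gauge body of `ℝⁿ`: a body `C` that is 0-symmetric, `C = -C`. -/
structure IsGaugeBody {n : ℕ} (C : Set (EuclideanSpace ℝ (Fin n))) : Prop extends IsBody C where
  symm : C = -C

/-- The Minkowski asymmetry `s(K) = inf {ρ > 0 : K - c ⊆ ρ (c - K), c ∈ ℝⁿ}`. -/
def minkowskiAsymmetry {n : ℕ} (K : Set (EuclideanSpace ℝ (Fin n))) : ℝ :=
  sInf {ρ : ℝ | 0 < ρ ∧ ∃ c : EuclideanSpace ℝ (Fin n), K - {c} ⊆ ρ • ({c} - K)}

/-- `max {⟪u, x⟫ : x ∈ A}`, the support function of `A` at `u`. -/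
def supportFun {n : ℕ} (A : Set (EuclideanSpace ℝ (Fin n))) (u : EuclideanSpace ℝ (Fin n)) : ℝ :=
  sSup ((fun x => inner ℝ u x) '' A)

/-- The breadth of `K` with respect to `C` in the direction `u`:
`max {⟪u, x - y⟫ : x, y ∈ K} / max {⟪u, x⟫ : x ∈ C}`. -/
def breadth {n : ℕ} (u : EuclideanSpace ℝ (Fin n)) (K C : Set (EuclideanSpace ℝ (Fin n))) : ℝ :=
  supportFun (K - K) u / supportFun C u

/-- The width `w(K, C)`: the minimal breadth over all nonzero directions. -/
def bodyWidth {n : ℕ} (K C : Set (EuclideanSpace ℝ (Fin n))) : ℝ :=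
  ⨅ u : {u : EuclideanSpace ℝ (Fin n) // u ≠ 0}, breadth u.1 K C

/-- The diameter `D(K, C)`: the maximal breadth over all nonzero directions. -/
def bodyDiam {n : ℕ} (K C : Set (EuclideanSpace ℝ (Fin n))) : ℝ :=
  ⨆ u : {u : EuclideanSpace ℝ (Fin n) // u ≠ 0}, breadth u.1 K C

/-- The circumradius `R(K, C) = inf {ρ > 0 : K ⊆ ρ C + t for some t ∈ ℝⁿ}`. -/
def circumradius {n : ℕ} (K C : Set (EuclideanSpace ℝ (Fin n))) : ℝ :=
  sInf {ρ : ℝ | 0 < ρ ∧ ∃ t : EuclideanSpace ℝ (Fin n), K ⊆ ρ • C + {t}}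

/-- The inradius `r(K, C) = sup {ρ > 0 : ρ C ⊆ K + t for some t ∈ ℝⁿ}`. -/
def inradius {n : ℕ} (K C : Set (EuclideanSpace ℝ (Fin n))) : ℝ :=
  sSup {ρ : ℝ | 0 < ρ ∧ ∃ t : EuclideanSpace ℝ (Fin n), ρ • C ⊆ K + {t}}

/-- `K` is pseudo-complete with respect to `C`: `r(K, C) + R(K, C) = D(K, C)`. -/
def IsPseudoComplete {n : ℕ} (K C : Set (EuclideanSpace ℝ (Fin n))) : Prop :=
  inradius K C + circumradius K C = bodyDiam K C

/-- `K` is (diametrically) complete with respect to `C`: every proper superset of `K` has a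
greater diameter.  Unbounded supersets have infinite diameter, so that only the bounded ones
(on which the real-valued `bodyDiam` is the true supremum) impose a condition. -/
def IsDiamComplete {n : ℕ} (K C : Set (EuclideanSpace ℝ (Fin n))) : Prop :=
  ∀ L : Set (EuclideanSpace ℝ (Fin n)), Bornology.IsBounded L → K ⊂ L → bodyDiam K C < bodyDiam L C

end

/-! ### Support functions, breadths and the gauge. -/

section SupportFunction

variable {n : ℕ} {A K L C : Set (EuclideanSpace ℝ (Fin n))} {u x y : EuclideanSpace ℝ (Fin n)}

/-! For (1), let `K - c ⊆ ρ (c - K)` and let `D`, `R`, `r`, `w` be the diameter, circumradius,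
inradius and width. Each `x ∈ K` has a `k ∈ K` with `x - c = ρ (c - k)`, so `x - k = (1 + 1/ρ)(x -
c)`. Since `K - K ⊆ D C`, this gives `R ≤ ρ/(ρ+1) D` (`circumradius_le_mul_sub`).
Pseudo-completeness `r = D - R` turns it into `R ≤ ρ r`, so `D = r + R ≤ (s(K)+1) r`, and `2 r ≤ w`
finishes.

For (2), take `S` with `m` elements, `m` odd and `s ≤ m`. The normals `e_i` (`i ∈ S`) and `-∑_S e_i`
are those of a simplex and add up to zero. Let `C` have all facets at distance 1, and let `K` have
facets at distances 1 and `s` on opposite sides, with a centred interval of length `s + 1` in each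
coordinate outside `S`. All facet pairs of `K` are then `s + 1` apart and every facet is touched,
which yields diameter `s + 1` and completeness. The zero sum of the normals forces asymmetry `s`.
Oddness of `m` gives a direction, the sum of `(m+1)/2` coordinates, with breadth only 2. -/

theorem bddAbove_inner_image (hA : Bornology.IsBounded A) (u : EuclideanSpace ℝ (Fin n)) :
    BddAbove ((fun x => inner ℝ u x) '' A) := by
  obtain ⟨M, hM⟩ := hA.exists_norm_le
  refine ⟨‖u‖ * M, ?_⟩
  rintro _ ⟨x, hx, rfl⟩
  exact (real_inner_le_norm u x).trans (mul_le_mul_of_nonneg_left (hM x hx) (norm_nonneg u))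

theorem inner_le_supportFun (hA : Bornology.IsBounded A) (hx : x ∈ A) :
    inner ℝ u x ≤ supportFun A u :=
  le_csSup (bddAbove_inner_image hA u) ⟨x, hx, rfl⟩

theorem supportFun_le {c : ℝ} (hA : A.Nonempty) (h : ∀ x ∈ A, inner ℝ u x ≤ c) :
    supportFun A u ≤ c := by
  refine csSup_le (hA.image _) ?_
  rintro _ ⟨x, hx, rfl⟩
  exact h x hx

theorem IsCompact.exists_inner_eq_supportFun (hA : IsCompact A) (hne : A.Nonempty)
    (u : EuclideanSpace ℝ (Fin n)) : ∃ x ∈ A, inner ℝ u x = supportFun A u := by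
  obtain ⟨x, hx, hmax⟩ := hA.exists_isMaxOn hne
    (f := fun x => inner ℝ u x) (by fun_prop)
  exact ⟨x, hx, le_antisymm (inner_le_supportFun hA.isBounded hx)
    (supportFun_le hne fun y hy => hmax hy)⟩

theorem IsBody.nonempty (hK : IsBody K) : K.Nonempty :=
  hK.interior_nonempty.mono interior_subset

theorem IsGaugeBody.neg_mem (hC : IsGaugeBody C) (hx : x ∈ C) : -x ∈ C := by
  rw [hC.symm]
  simpa using hx

theorem IsGaugeBody.zero_mem_interior (hC : IsGaugeBody C) : (0 : EuclideanSpace ℝ (Fin n)) ∈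
    interior C := by
  obtain ⟨x, hx⟩ := hC.interior_nonempty
  have h := hC.convex.combo_interior_self_mem_interior hx (hC.neg_mem (interior_subset hx))
    (a := 1 / 2) (b := 1 / 2) (by norm_num) (by norm_num) (by norm_num)
  simpa using h

theorem IsGaugeBody.exists_mul_norm_le_supportFun (hC : IsGaugeBody C) :
    ∃ ε > 0, ∀ u, ε * ‖u‖ ≤ supportFun C u := by
  obtain ⟨ε, hε, hball⟩ := Metric.mem_nhds_iff.1 (mem_interior_iff_mem_nhds.1 hC.zero_mem_interior)
  refine ⟨ε / 2, by positivity, fun u => ?_⟩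
  rcases eq_or_ne u 0 with rfl | hu
  · have := inner_le_supportFun (u := 0) hC.isCompact.isBounded
      (interior_subset hC.zero_mem_interior)
    simpa using this
  · have hu' : 0 < ‖u‖ := norm_pos_iff.2 hu
    have hmem : (ε / 2 / ‖u‖) • u ∈ C := by
      apply hball
      rw [mem_ball_zero_iff, norm_smul, Real.norm_of_nonneg (by positivity),
        div_mul_cancel₀ _ hu'.ne']
      linarith
    have := inner_le_supportFun (u := u) hC.isCompact.isBounded hmem
    rw [real_inner_smul_right, real_inner_self_eq_norm_sq] at this
    calc ε / 2 * ‖u‖ = ε / 2 / ‖u‖ * ‖u‖ ^ 2 := by field_simp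
      _ ≤ _ := this

theorem IsGaugeBody.supportFun_pos (hC : IsGaugeBody C) (hu : u ≠ 0) : 0 < supportFun C u := by
  obtain ⟨ε, hε, h⟩ := hC.exists_mul_norm_le_supportFun
  exact (mul_pos hε (norm_pos_iff.2 hu)).trans_le (h u)

theorem supportFun_sub_self_nonneg (hL : Bornology.IsBounded L) (hne : L.Nonempty) :
    0 ≤ supportFun (L - L) u := by
  obtain ⟨x, hx⟩ := hne
  simpa using inner_le_supportFun (u := u) (hL.sub hL) (Set.sub_mem_sub hx hx)

theorem breadth_nonneg (hC : IsGaugeBody C) (hL : Bornology.IsBounded L) (hne : L.Nonempty)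
    (hu : u ≠ 0) : 0 ≤ breadth u L C :=
  div_nonneg (supportFun_sub_self_nonneg hL hne) (hC.supportFun_pos hu).le

theorem bddBelow_breadth (hC : IsGaugeBody C) (hL : Bornology.IsBounded L) (hne : L.Nonempty) :
    BddBelow (Set.range fun u : {u : EuclideanSpace ℝ (Fin n) // u ≠ 0} => breadth u.1 L C) := by
  refine ⟨0, ?_⟩
  rintro _ ⟨u, rfl⟩
  exact breadth_nonneg hC hL hne u.2

theorem bddAbove_breadth (hC : IsGaugeBody C) (hL : Bornology.IsBounded L) (hne : L.Nonempty) :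
    BddAbove (Set.range fun u : {u : EuclideanSpace ℝ (Fin n) // u ≠ 0} => breadth u.1 L C) := by
  obtain ⟨ε, hε, h⟩ := hC.exists_mul_norm_le_supportFun
  obtain ⟨M, hM⟩ := (hL.sub hL).exists_norm_le
  refine ⟨M / ε, ?_⟩
  rintro _ ⟨⟨u, hu⟩, rfl⟩
  have hu' : 0 < ‖u‖ := norm_pos_iff.2 hu
  have hM0 : 0 ≤ M := by
    obtain ⟨x, hx⟩ := hne
    exact (norm_nonneg _).trans (hM _ (Set.sub_mem_sub hx hx))
  have hs : supportFun (L - L) u ≤ ‖u‖ * M := supportFun_le (hne.sub hne) fun x hx =>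
    (real_inner_le_norm u x).trans (mul_le_mul_of_nonneg_left (hM x hx) (norm_nonneg u))
  simp only [breadth]
  rw [div_le_div_iff₀ (hC.supportFun_pos hu) hε]
  calc supportFun (L - L) u * ε ≤ ‖u‖ * M * ε := by gcongr
    _ = M * (ε * ‖u‖) := by ring
    _ ≤ M * supportFun C u := by gcongr; exact h u

theorem inner_sub_le_bodyDiam_mul (hC : IsGaugeBody C) (hL : Bornology.IsBounded L)
    (hx : x ∈ L) (hy : y ∈ L) (u : EuclideanSpace ℝ (Fin n)) :
    inner ℝ u (x - y) ≤ bodyDiam L C * supportFun C u := by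
  rcases eq_or_ne u 0 with rfl | hu
  · obtain ⟨c, -, hc⟩ := hC.isCompact.exists_inner_eq_supportFun hC.nonempty 0
    simp [← hc]
  · have h : breadth u L C ≤ bodyDiam L C :=
      le_ciSup (bddAbove_breadth hC hL ⟨x, hx⟩) (⟨u, hu⟩ : {u : EuclideanSpace ℝ (Fin n) // u ≠ 0})
    rw [breadth, div_le_iff₀ (hC.supportFun_pos hu)] at h
    exact (inner_le_supportFun (hL.sub hL) (Set.sub_mem_sub hx hy)).trans h

theorem lt_bodyDiam_of_lt_inner_sub {d : ℝ} (hC : IsGaugeBody C) (hL : Bornology.IsBounded L)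
    (hd : 0 ≤ d) (hx : x ∈ L) (hy : y ∈ L) (hu : ∀ c ∈ C, inner ℝ u c ≤ 1)
    (h : d < inner ℝ u (x - y)) : d < bodyDiam L C := by
  have hu0 : u ≠ 0 := by
    rintro rfl
    simp at h
    linarith
  have h1 := inner_sub_le_bodyDiam_mul hC hL hx hy u
  have h2 : supportFun C u ≤ 1 := supportFun_le hC.nonempty hu
  have h3 := hC.supportFun_pos hu0
  by_contra! hle
  nlinarith

theorem bodyWidth_nonneg (hC : IsGaugeBody C) (hL : Bornology.IsBounded L) (hne : L.Nonempty) :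
    0 ≤ bodyWidth L C :=
  Real.iInf_nonneg fun u => breadth_nonneg hC hL hne u.2

/-- A difference outside the closed convex set `D C` could be strictly separated from it, giving a
direction of breadth greater than `D`. -/
theorem sub_mem_bodyDiam_smul (hC : IsGaugeBody C) (hL : Bornology.IsBounded L)
    (hx : x ∈ L) (hy : y ∈ L) : x - y ∈ bodyDiam L C • C := by
  by_contra hxy
  obtain ⟨f, t, hft, htf⟩ := geometric_hahn_banach_closed_point (hC.convex.smul (bodyDiam L C))
    (hC.isCompact.smul (bodyDiam L C)).isClosed hxy
  set u := (InnerProductSpace.toDual ℝ (EuclideanSpace ℝ (Fin n))).symm f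
  have hu : ∀ z, f z = inner ℝ u z := fun z => by
    simp [u]
  obtain ⟨c, hcC, hc⟩ := hC.isCompact.exists_inner_eq_supportFun hC.nonempty u
  have h1 := inner_sub_le_bodyDiam_mul hC hL hx hy u
  have h2 := hft _ (Set.smul_mem_smul_set (a := bodyDiam L C) hcC)
  rw [hu, real_inner_smul_right, hc] at h2
  rw [hu] at htf
  linarith

/-! ### Diameter, width, radii and asymmetry: the upper bound. -/

theorem IsBody.bodyDiam_pos (hn : 1 ≤ n) (hK : IsBody K) (hC : IsGaugeBody C) :
    0 < bodyDiam K C := by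
  have : Nontrivial (EuclideanSpace ℝ (Fin n)) := by
    have : Nonempty (Fin n) := ⟨⟨0, hn⟩⟩
    infer_instance
  obtain ⟨x, hx, y, hy, hxy⟩ : K.Nontrivial := by
    obtain ⟨c, hc⟩ := hK.interior_nonempty
    by_contra h
    rw [Set.not_nontrivial_iff] at h
    have hsing := h.eq_singleton_of_mem (interior_subset hc)
    rw [hsing, interior_singleton] at hc
    exact hc
  have h := inner_sub_le_bodyDiam_mul hC hK.isCompact.isBounded hx hy (x - y)
  have h1 : 0 < inner ℝ (x - y) (x - y) := real_inner_self_pos.2 (sub_ne_zero.2 hxy)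
  exact pos_of_mul_pos_left (h1.trans_le h) (hC.supportFun_pos (sub_ne_zero.2 hxy)).le

theorem le_bodyWidth_of_smul_subset {ρ : ℝ} {t : EuclideanSpace ℝ (Fin n)} (hn : 1 ≤ n)
    (hL : Bornology.IsBounded L) (hC : IsGaugeBody C) (h : ρ • C ⊆ L + {t}) :
    2 * ρ ≤ bodyWidth L C := by
  have : Nonempty (Fin n) := ⟨⟨0, hn⟩⟩
  have : Nonempty {u : EuclideanSpace ℝ (Fin n) // u ≠ 0} := by
    obtain ⟨u, hu⟩ := exists_ne (0 : EuclideanSpace ℝ (Fin n))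
    exact ⟨⟨u, hu⟩⟩
  refine le_ciInf fun ⟨u, hu⟩ => ?_
  simp only [breadth]
  rw [le_div_iff₀ (hC.supportFun_pos hu)]
  obtain ⟨c, hcC, hc⟩ := hC.isCompact.exists_inner_eq_supportFun hC.nonempty u
  obtain ⟨x, hx, _, rfl, hxc⟩ := h (Set.smul_mem_smul_set hcC)
  obtain ⟨y, hy, _, rfl, hyc⟩ := h (Set.smul_mem_smul_set (hC.neg_mem hcC))
  have hxy : x - y = (2 * ρ) • c := by
    simp only at hxc hyc
    have h1 : x - y = ρ • c - ρ • (-c) := by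
      rw [← hxc, ← hyc]; abel
    rw [h1]; module
  have := inner_le_supportFun (u := u) (hL.sub hL) (Set.sub_mem_sub hx hy)
  rwa [hxy, real_inner_smul_right, hc] at this

theorem two_mul_inradius_le_bodyWidth (hn : 1 ≤ n) (hL : Bornology.IsBounded L) (hne : L.Nonempty)
    (hC : IsGaugeBody C) : 2 * inradius L C ≤ bodyWidth L C := by
  have : inradius L C ≤ bodyWidth L C / 2 := by
    -- The supremum of an empty set is 0 here, so the bound must also be nonnegative.
    refine Real.sSup_le ?_ (div_nonneg (bodyWidth_nonneg hC hL hne) zero_le_two)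
    rintro ρ ⟨-, t, ht⟩
    linarith [le_bodyWidth_of_smul_subset hn hL hC ht]
  linarith

theorem circumradius_le_mul_sub {ρ : ℝ} {c : EuclideanSpace ℝ (Fin n)} (hC : IsGaugeBody C)
    (hL : Bornology.IsBounded L) (hD : 0 < bodyDiam L C) (hρ : 0 < ρ)
    (h : L - {c} ⊆ ρ • ({c} - L)) :
    circumradius L C ≤ ρ * (bodyDiam L C - circumradius L C) := by
  have key : circumradius L C ≤ ρ / (ρ + 1) * bodyDiam L C := by
    refine csInf_le ⟨0, fun r hr => hr.1.le⟩ ⟨by positivity, c, fun x hx => ?_⟩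
    obtain ⟨_, ⟨c', hc', k, hk, rfl⟩, hxk⟩ := h (Set.sub_mem_sub hx rfl)
    obtain rfl : c = c' := hc'.symm
    obtain ⟨z, hz, hxz⟩ := sub_mem_bodyDiam_smul hC hL hx hk
    refine ⟨_, ⟨z, hz, rfl⟩, c, rfl, ?_⟩
    simp only at hxk hxz ⊢
    rw [mul_smul, hxz]
    have hxk' : x - k = ((ρ + 1) / ρ) • (x - c) := by
      rw [← hxk, smul_smul, div_mul_cancel₀ _ hρ.ne', add_smul, hxk]
      module
    rw [hxk', smul_smul, div_mul_div_cancel₀ (by positivity), div_self hρ.ne', one_smul]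
    abel
  rw [div_mul_eq_mul_div, le_div_iff₀ (by positivity)] at key
  linarith

/-- `K` lies between balls of radii `ε` and `M` about an interior point `c`, so `M / ε` is
admissible. This rules out the default value 0 of the infimum over an empty set. -/
theorem IsBody.exists_asymmetry_bound (hK : IsBody K) :
    {ρ : ℝ | 0 < ρ ∧ ∃ c : EuclideanSpace ℝ (Fin n), K - {c} ⊆ ρ • ({c} - K)}.Nonempty := by
  obtain ⟨c, hc⟩ := hK.interior_nonempty
  obtain ⟨ε, hε, hball⟩ := Metric.mem_nhds_iff.1 (mem_interior_iff_mem_nhds.1 hc)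
  obtain ⟨M, hM, hKM⟩ := hK.isCompact.isBounded.subset_ball_lt 0 c
  refine ⟨M / ε, div_pos hM hε, c, ?_⟩
  rintro _ ⟨x, hx, c', hc', rfl⟩
  obtain rfl : c = c' := hc'.symm
  refine ⟨(M / ε)⁻¹ • (x - c), ⟨c, rfl, c - (M / ε)⁻¹ • (x - c), hball ?_, by simp⟩, ?_⟩
  · have hxM := hKM hx
    rw [mem_ball_iff_norm] at hxM
    rw [mem_ball_iff_norm, sub_sub_cancel_left, norm_neg, norm_smul,
      Real.norm_of_nonneg (by positivity), inv_div, div_mul_eq_mul_div, div_lt_iff₀ hM]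
    gcongr
  · exact smul_inv_smul₀ (by positivity) _

theorem bodyDiam_div_bodyWidth_le (hn : 1 ≤ n) (hK : IsBody K) (hC : IsGaugeBody C)
    (h : IsPseudoComplete K C) :
    bodyDiam K C / bodyWidth K C ≤ (minkowskiAsymmetry K + 1) / 2 := by
  have hb := hK.isCompact.isBounded
  have hD := hK.bodyDiam_pos hn hC
  have hw := two_mul_inradius_le_bodyWidth hn hb hK.nonempty hC
  unfold IsPseudoComplete at h
  have hr : bodyDiam K C - circumradius K C = inradius K C := by linarith
  have hle : ∀ ρ ∈ {ρ : ℝ | 0 < ρ ∧ ∃ c : EuclideanSpace ℝ (Fin n), K - {c} ⊆ ρ • ({c} - K)},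
      0 < inradius K C ∧ circumradius K C / inradius K C ≤ ρ := by
    rintro ρ ⟨hρ, c, hc⟩
    have h1 := circumradius_le_mul_sub hC hb hD hρ hc
    rw [hr] at h1
    -- If `r ≤ 0`, then `R ≤ ρ r ≤ 0`, contradicting `r + R = D > 0`.
    have h2 : 0 < inradius K C := by
      by_contra! h0
      nlinarith
    exact ⟨h2, (div_le_iff₀ h2).2 h1⟩
  have hr0 : 0 < inradius K C := by
    obtain ⟨ρ, hρ⟩ := hK.exists_asymmetry_bound
    exact (hle ρ hρ).1
  have hs : circumradius K C / inradius K C ≤ minkowskiAsymmetry K :=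
    le_csInf hK.exists_asymmetry_bound fun ρ hρ => (hle ρ hρ).2
  have hs0 : 0 ≤ minkowskiAsymmetry K := Real.sInf_nonneg fun ρ hρ => hρ.1.le
  rw [div_le_iff₀ hr0] at hs
  rw [div_le_iff₀ (by linarith)]
  nlinarith

end SupportFunction

/-! ### Polytopes with prescribed facet distances. -/

section Construction

variable {n : ℕ} {S : Finset (Fin n)} {s : ℝ}

/-- The coordinate vectors, together with minus the sum of those with index in `S`. -/
noncomputable def facetNormal (S : Finset (Fin n)) : Option (Fin n) → EuclideanSpace ℝ (Fin n)
  | none => -∑ i ∈ S, EuclideanSpace.single i 1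
  | some i => EuclideanSpace.single i 1

/-- The polytope with facet normals `± facetNormal S o`, at distances `a o` and `b o`. -/
def facetPolytope (S : Finset (Fin n)) (a b : Option (Fin n) → ℝ) :
    Set (EuclideanSpace ℝ (Fin n)) :=
  {x | ∀ o, inner ℝ (facetNormal S o) x ∈ Set.Icc (-a o) (b o)}

theorem inner_facetNormal_some (i : Fin n) (x : EuclideanSpace ℝ (Fin n)) :
    inner ℝ (facetNormal S (some i)) x = x i := by
  simp [facetNormal, EuclideanSpace.inner_single_left]

theorem inner_facetNormal_none (x : EuclideanSpace ℝ (Fin n)) :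
    inner ℝ (facetNormal S none) x = -∑ i ∈ S, x i := by
  simp [facetNormal, EuclideanSpace.inner_single_left, sum_inner]

theorem isBody_facetPolytope {a b : Option (Fin n) → ℝ} (ha : ∀ o, 0 < a o) (hb : ∀ o, 0 < b o) :
    IsBody (facetPolytope S a b) where
  convex := by
    simp only [facetPolytope, Set.ofPred_forall]
    exact convex_iInter fun o => (convex_Icc _ _).is_linear_preimage
      ⟨fun x y => inner_add_right _ _ _, fun c x => real_inner_smul_right _ _ _⟩
  isCompact := by
    refine Metric.isCompact_of_isClosed_isBounded ?_ ?_
    · simp only [facetPolytope, Set.ofPred_forall]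
      exact isClosed_iInter fun o => isClosed_Icc.preimage (by fun_prop)
    · refine isBounded_iff_forall_norm_le.2 ⟨∑ i, (a (some i) + b (some i)), fun x hx => ?_⟩
      have hx' : x = ∑ i, x i • EuclideanSpace.single i (1 : ℝ) := by
        ext j
        simp [Pi.single_apply]
      rw [hx']
      refine (norm_sum_le _ _).trans (Finset.sum_le_sum fun i _ => ?_)
      have h := hx (some i)
      rw [inner_facetNormal_some] at h
      have := ha (some i)
      have := hb (some i)
      simp only [norm_smul, PiLp.norm_single, norm_one, mul_one, Real.norm_eq_abs]
      exact abs_le.2 ⟨by linarith [h.1], by linarith [h.2]⟩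
  interior_nonempty := by
    refine ⟨0, mem_interior.2 ⟨{x | ∀ o, inner ℝ (facetNormal S o) x ∈ Set.Ioo (-a o) (b o)},
      fun x hx o => Set.Ioo_subset_Icc_self (hx o), ?_, fun o => ?_⟩⟩
    · simp only [Set.ofPred_forall]
      exact isOpen_iInter_of_finite fun o => isOpen_Ioo.preimage (by fun_prop)
    · simpa using ⟨ha o, hb o⟩

/-- The gauge body `{x : |⟪facetNormal S o, x⟫| ≤ 1}`. -/
def facetGauge (S : Finset (Fin n)) : Set (EuclideanSpace ℝ (Fin n)) :=
  facetPolytope S (fun _ => 1) (fun _ => 1)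

theorem isGaugeBody_facetGauge : IsGaugeBody (facetGauge S) where
  toIsBody := isBody_facetPolytope (fun _ => one_pos) (fun _ => one_pos)
  symm := by
    ext x
    simp only [facetGauge, facetPolytope, Set.mem_neg, Set.mem_ofPred_eq, inner_neg_right,
      Set.mem_Icc]
    exact forall_congr' fun o => ⟨fun h => ⟨by linarith, by linarith⟩,
      fun h => ⟨by linarith, by linarith⟩⟩

/-- The lower facet distances of the extremal body: `1`, in the coordinates outside `S`
`(s + 1) / 2`. -/
noncomputable def lowerDist (S : Finset (Fin n)) (s : ℝ) : Option (Fin n) → ℝ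
  | none => 1
  | some i => if i ∈ S then 1 else (s + 1) / 2

/-- The upper facet distances of the extremal body: `s`, in the coordinates outside `S`
`(s + 1) / 2`. -/
noncomputable def upperDist (S : Finset (Fin n)) (s : ℝ) : Option (Fin n) → ℝ
  | none => s
  | some i => if i ∈ S then s else (s + 1) / 2

/-- The extremal body: the product of a simplex, truncated in such a way that its asymmetry is `s`,
and a cube. -/
def extremalBody (S : Finset (Fin n)) (s : ℝ) : Set (EuclideanSpace ℝ (Fin n)) :=
  facetPolytope S (lowerDist S s) (upperDist S s)

theorem lowerDist_add_upperDist (o : Option (Fin n)) :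
    lowerDist S s o + upperDist S s o = s + 1 := by
  rcases o with _ | i
  · simp [lowerDist, upperDist, add_comm]
  · by_cases hi : i ∈ S <;> simp [lowerDist, upperDist, hi, add_comm]

theorem one_le_lowerDist (hs : 1 ≤ s) (o : Option (Fin n)) : 1 ≤ lowerDist S s o := by
  rcases o with _ | i
  · simp [lowerDist]
  · by_cases hi : i ∈ S <;> simp [lowerDist, hi]
    linarith

theorem one_le_upperDist (hs : 1 ≤ s) (o : Option (Fin n)) : 1 ≤ upperDist S s o := by
  rcases o with _ | i
  · simpa [upperDist]
  · by_cases hi : i ∈ S <;> simp [upperDist, hi] <;> linarith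

theorem upperDist_le_mul_lowerDist (hs : 1 ≤ s) (o : Option (Fin n)) :
    upperDist S s o ≤ s * lowerDist S s o := by
  rcases o with _ | i
  · simp [lowerDist, upperDist]
  · by_cases hi : i ∈ S <;> simp [lowerDist, upperDist, hi]
    nlinarith

theorem lowerDist_le_mul_upperDist (hs : 1 ≤ s) (o : Option (Fin n)) :
    lowerDist S s o ≤ s * upperDist S s o := by
  rcases o with _ | i
  · simp only [lowerDist, upperDist]
    nlinarith
  · by_cases hi : i ∈ S <;> simp only [lowerDist, upperDist, hi, if_true, if_false] <;> nlinarith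

theorem isBody_extremalBody (hs : 1 ≤ s) : IsBody (extremalBody S s) :=
  isBody_facetPolytope (fun o => one_pos.trans_le (one_le_lowerDist hs o))
    (fun o => one_pos.trans_le (one_le_upperDist hs o))

theorem facetGauge_subset_extremalBody (hs : 1 ≤ s) : facetGauge S ⊆ extremalBody S s :=
  fun _ hx o => ⟨(neg_le_neg (one_le_lowerDist hs o)).trans (hx o).1,
    (hx o).2.trans (one_le_upperDist hs o)⟩

/-- No facet inequality is redundant. This is where `s ≤ |S|` enters: it keeps `-t / |S|` in `[-1,
s]` for all `t ∈ [-1, s]`. -/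
theorem exists_mem_extremalBody_inner_eq {t : ℝ} (hS : S.Nonempty) (hs : 1 ≤ s) (hsS : s ≤ S.card)
    (o : Option (Fin n)) (ht : t ∈ Set.Icc (-lowerDist S s o) (upperDist S s o)) :
    ∃ x ∈ extremalBody S s, inner ℝ (facetNormal S o) x = t := by
  have hm : (1 : ℝ) ≤ S.card := by exact_mod_cast hS.card_pos
  have hmem : ∀ t : ℝ, t ∈ Set.Icc (-1) s → -t / S.card ∈ Set.Icc (-1) s := by
    rintro t ⟨h1, h2⟩
    refine ⟨?_, ?_⟩
    · rw [le_div_iff₀ (by linarith)]; linarith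
    · rw [div_le_iff₀ (by linarith)]; nlinarith
  have hsingle : ∀ i ∉ S, ∑ j ∈ S, (if j = i then t else 0 : ℝ) = 0 := fun i hi =>
    Finset.sum_eq_zero fun j hj => if_neg (by rintro rfl; exact hi hj)
  rcases o with _ | i
  · have ht' := hmem t ht
    refine ⟨WithLp.toLp 2 fun j => if j ∈ S then -t / S.card else 0, fun o => ?_, ?_⟩
    · rcases o with _ | j
      · rw [inner_facetNormal_none]
        simp only [Finset.sum_ite_mem, Finset.inter_self, Finset.sum_const, nsmul_eq_mul]
        rw [mul_div_cancel₀ _ (by positivity), neg_neg]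
        exact ht
      · rw [inner_facetNormal_some]
        by_cases hj : j ∈ S
        · simpa [hj, lowerDist, upperDist] using ht'
        · simp [hj, lowerDist, upperDist]; linarith
    · rw [inner_facetNormal_none]
      simp only [Finset.sum_ite_mem, Finset.inter_self, Finset.sum_const, nsmul_eq_mul]
      rw [mul_div_cancel₀ _ (by positivity), neg_neg]
  · by_cases hi : i ∈ S
    · simp only [lowerDist, upperDist, hi, if_true] at ht
      have ht' := hmem t ht
      -- The value `t` at one simplex normal is balanced by `-t / |S|` at each of the other `|S|`
      -- normals, as the values must add up to zero.
      refine ⟨WithLp.toLp 2 fun j => if j = i then t else if j ∈ S then -t / S.card else 0,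
        fun o => ?_, ?_⟩
      · rcases o with _ | j
        · rw [inner_facetNormal_none]
          have : -∑ j ∈ S, (if j = i then t else if j ∈ S then -t / S.card else 0 : ℝ)
              = -t / S.card := by
            rw [← Finset.add_sum_erase S _ hi, Finset.sum_congr rfl (g := fun _ => -t / S.card)]
            · rw [Finset.sum_const, Finset.card_erase_of_mem hi, nsmul_eq_mul,
                Nat.cast_sub hS.card_pos]
              simp
              field_simp
              ring
            · intro j hj
              rw [Finset.mem_erase] at hj
              simp [hj]
          simp only [this]
          exact ht'
        · rw [inner_facetNormal_some]
          by_cases hji : j = i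
          · subst hji
            simpa [hi, lowerDist, upperDist] using ht
          by_cases hj : j ∈ S
          · simpa [hj, hji, lowerDist, upperDist] using ht'
          · simp [hj, hji, lowerDist, upperDist]; linarith
      · rw [inner_facetNormal_some]
        simp
    · simp only [lowerDist, upperDist, hi, if_false] at ht
      refine ⟨WithLp.toLp 2 fun j => if j = i then t else 0, fun o => ?_, ?_⟩
      · rcases o with _ | j
        · rw [inner_facetNormal_none]
          simp only [hsingle i hi, lowerDist, upperDist]
          constructor <;> linarith
        · rw [inner_facetNormal_some]
          by_cases hji : j = i
          · subst hji
            simpa [hi, lowerDist, upperDist] using ht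
          · by_cases hj : j ∈ S
            · simp [hj, hji, lowerDist, upperDist]; linarith
            · simp [hj, hji, lowerDist, upperDist]; linarith
      · rw [inner_facetNormal_some]
        simp

theorem exists_mem_extremalBody_inner_eq_upperDist (hS : S.Nonempty) (hs : 1 ≤ s)
    (hsS : s ≤ S.card) (o : Option (Fin n)) :
    ∃ x ∈ extremalBody S s, inner ℝ (facetNormal S o) x = upperDist S s o :=
  exists_mem_extremalBody_inner_eq hS hs hsS o
    ⟨by linarith [one_le_lowerDist (S := S) hs o, one_le_upperDist (S := S) hs o], le_rfl⟩

theorem exists_mem_extremalBody_inner_eq_neg_lowerDist (hS : S.Nonempty) (hs : 1 ≤ s)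
    (hsS : s ≤ S.card) (o : Option (Fin n)) :
    ∃ x ∈ extremalBody S s, inner ℝ (facetNormal S o) x = -lowerDist S s o :=
  exists_mem_extremalBody_inner_eq hS hs hsS o
    ⟨le_rfl, by linarith [one_le_lowerDist (S := S) hs o, one_le_upperDist (S := S) hs o]⟩

/-! ### Diameter and completeness of the extremal body. -/

theorem bodyDiam_extremalBody_le (hn : 1 ≤ n) (hs : 1 ≤ s) :
    bodyDiam (extremalBody S s) (facetGauge S) ≤ s + 1 := by
  have : Nonempty (Fin n) := ⟨⟨0, hn⟩⟩
  have : Nonempty {u : EuclideanSpace ℝ (Fin n) // u ≠ 0} := by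
    obtain ⟨u, hu⟩ := exists_ne (0 : EuclideanSpace ℝ (Fin n))
    exact ⟨⟨u, hu⟩⟩
  have hC := isGaugeBody_facetGauge (S := S)
  have hne := (isBody_extremalBody (S := S) hs).nonempty
  refine ciSup_le fun ⟨u, hu⟩ => ?_
  simp only [breadth]
  rw [div_le_iff₀ (hC.supportFun_pos hu)]
  refine supportFun_le (hne.sub hne) ?_
  rintro _ ⟨x, hx, y, hy, rfl⟩
  have hmem : (s + 1)⁻¹ • (x - y) ∈ facetGauge S := by
    intro o
    have h1 := hx o
    have h2 := hy o
    have h3 := lowerDist_add_upperDist (S := S) (s := s) o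
    rw [real_inner_smul_right, inner_sub_right, inv_mul_eq_div]
    constructor
    · rw [le_div_iff₀ (by linarith)]; linarith [h1.1, h2.2]
    · rw [div_le_iff₀ (by linarith)]; linarith [h1.2, h2.1]
  have h := inner_le_supportFun (u := u) hC.isCompact.isBounded hmem
  rwa [real_inner_smul_right, inv_mul_le_iff₀ (by linarith)] at h

theorem le_bodyDiam_extremalBody (hS : S.Nonempty) (hs : 1 ≤ s) (hsS : s ≤ S.card) :
    s + 1 ≤ bodyDiam (extremalBody S s) (facetGauge S) := by
  obtain ⟨x, hx, hx'⟩ := exists_mem_extremalBody_inner_eq_upperDist hS hs hsS none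
  obtain ⟨y, hy, hy'⟩ := exists_mem_extremalBody_inner_eq_neg_lowerDist hS hs hsS none
  -- `d` is replaced by `max d 0` because the strict bound needs a nonnegative number.
  refine le_of_forall_lt fun d hd => ?_
  refine (le_max_left d 0).trans_lt (lt_bodyDiam_of_lt_inner_sub isGaugeBody_facetGauge
    (isBody_extremalBody hs).isCompact.isBounded (le_max_right d 0) hx hy
    (fun c hc => (hc none).2) ?_)
  rw [inner_sub_right, hx', hy']
  simp only [upperDist, lowerDist]
  exact max_lt (by linarith) (by linarith)

theorem bodyDiam_extremalBody (hn : 1 ≤ n) (hS : S.Nonempty) (hs : 1 ≤ s) (hsS : s ≤ S.card) :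
    bodyDiam (extremalBody S s) (facetGauge S) = s + 1 :=
  le_antisymm (bodyDiam_extremalBody_le hn hs) (le_bodyDiam_extremalBody hS hs hsS)

/-- A new point lies strictly beyond some facet, while the opposite facet, `s + 1` away, contains a
point of the body. -/
theorem isDiamComplete_extremalBody (hn : 1 ≤ n) (hS : S.Nonempty) (hs : 1 ≤ s)
    (hsS : s ≤ S.card) : IsDiamComplete (extremalBody S s) (facetGauge S) := by
  intro L hL hKL
  rw [bodyDiam_extremalBody hn hS hs hsS]
  obtain ⟨hsub, z, hzL, hzK⟩ := Set.ssubset_iff_exists.1 hKL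
  obtain ⟨o, ho⟩ : ∃ o, inner ℝ (facetNormal S o) z ∉
      Set.Icc (-lowerDist S s o) (upperDist S s o) := by
    by_contra! h
    exact hzK h
  have hab := lowerDist_add_upperDist (S := S) (s := s) o
  have hC := isGaugeBody_facetGauge (S := S)
  rw [Set.mem_Icc, not_and_or, not_le, not_le] at ho
  rcases ho with ho | ho
  · obtain ⟨y, hy, hy'⟩ := exists_mem_extremalBody_inner_eq_upperDist hS hs hsS o
    refine lt_bodyDiam_of_lt_inner_sub hC hL (by linarith) (hsub hy) hzL
      (fun c hc => (hc o).2) ?_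
    rw [inner_sub_right, hy']
    linarith
  · obtain ⟨y, hy, hy'⟩ := exists_mem_extremalBody_inner_eq_neg_lowerDist hS hs hsS o
    refine lt_bodyDiam_of_lt_inner_sub hC hL (by linarith) hzL (hsub hy)
      (fun c hc => (hc o).2) ?_
    rw [inner_sub_right, hy']
    linarith

/-! ### Asymmetry of the extremal body. -/

theorem minkowskiAsymmetry_extremalBody_le (hs : 1 ≤ s) :
    minkowskiAsymmetry (extremalBody S s) ≤ s := by
  have hs0 : 0 < s := by linarith
  refine csInf_le ⟨0, fun ρ hρ => hρ.1.le⟩ ⟨hs0, 0, ?_⟩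
  rintro _ ⟨x, hx, _, rfl, rfl⟩
  refine ⟨s⁻¹ • x, ⟨0, rfl, -(s⁻¹ • x), fun o => ?_, by simp⟩, by simp [smul_smul, hs0.ne']⟩
  rw [inner_neg_right, real_inner_smul_right, inv_mul_eq_div, ← neg_div]
  have h := hx o
  have h1 := upperDist_le_mul_lowerDist (S := S) hs o
  have h2 := lowerDist_le_mul_upperDist (S := S) hs o
  constructor
  · rw [le_div_iff₀ hs0]; linarith [h.2]
  · rw [div_le_iff₀ hs0]; linarith [h.1]

/-- Each simplex normal gives an inequality between the two facet distances measured from `c`.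
Summed over all `|S| + 1` of them, the terms in `c` cancel, leaving `(|S|+1) s ≤ ρ (|S|+1)`. -/
theorem le_minkowskiAsymmetry_extremalBody (hS : S.Nonempty) (hs : 1 ≤ s) (hsS : s ≤ S.card) :
    s ≤ minkowskiAsymmetry (extremalBody S s) := by
  refine le_csInf (isBody_extremalBody hs).exists_asymmetry_bound ?_
  rintro ρ ⟨hρ, c, hc⟩
  have key : ∀ o, upperDist S s o - inner ℝ (facetNormal S o) c ≤
      ρ * (inner ℝ (facetNormal S o) c + lowerDist S s o) := by
    intro o
    obtain ⟨x, hx, hx'⟩ := exists_mem_extremalBody_inner_eq_upperDist hS hs hsS o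
    obtain ⟨_, ⟨_, rfl, k, hk, rfl⟩, hxk⟩ := hc (Set.sub_mem_sub hx rfl)
    have h := congrArg (fun z => inner ℝ (facetNormal S o) z) hxk
    simp only [real_inner_smul_right, inner_sub_right, hx'] at h
    rw [← h]
    have := (hk o).1
    gcongr
    linarith
  have hnone := key none
  have hsome : ∑ i ∈ S, (s - c i) ≤ ∑ i ∈ S, ρ * (c i + 1) := by
    refine Finset.sum_le_sum fun i hi => ?_
    have := key (some i)
    rw [inner_facetNormal_some] at this
    simpa [upperDist, lowerDist, hi] using this
  rw [inner_facetNormal_none] at hnone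
  simp only [upperDist, lowerDist] at hnone
  rw [← Finset.mul_sum, Finset.sum_sub_distrib, Finset.sum_add_distrib] at hsome
  simp only [Finset.sum_const, nsmul_eq_mul, mul_one] at hsome
  have hm : (0 : ℝ) ≤ S.card := Nat.cast_nonneg _
  by_contra! hlt
  nlinarith

/-! ### Width of the extremal body, and the conclusion. -/

theorem bodyWidth_extremalBody (hn : 1 ≤ n) (hS : Odd S.card) (hs : 1 ≤ s) :
    bodyWidth (extremalBody S s) (facetGauge S) = 2 := by
  have hC := isGaugeBody_facetGauge (S := S)
  have hK := isBody_extremalBody (S := S) hs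
  have hb := hK.isCompact.isBounded
  refine le_antisymm ?_ ?_
  · obtain ⟨k, hk⟩ := hS
    obtain ⟨A, hAS, hA⟩ := Finset.exists_subset_card_eq (s := S) (n := k + 1) (by omega)
    have hB : (S \ A).card = k := by
      rw [Finset.card_sdiff_of_subset hAS]; omega
    have hk0 : (0 : ℝ) < k + 1 := by positivity
    have hsplit (x : Fin n → ℝ) : ∑ i ∈ S, x i = ∑ i ∈ S \ A, x i + ∑ i ∈ A, x i :=
      (Finset.sum_sdiff hAS).symm
    set u : EuclideanSpace ℝ (Fin n) := ∑ i ∈ A, EuclideanSpace.single i 1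
    have hu : ∀ x, inner ℝ u x = ∑ i ∈ A, x i := fun x => by
      simp [u, EuclideanSpace.inner_single_left, sum_inner]
    have hCu : (k : ℝ) + 1 ≤ supportFun (facetGauge S) u := by
      -- With `|S| = 2k + 1`, the `k + 1` ones and `k` minus ones sum to exactly 1, so `p` just
      -- satisfies the last facet inequality.
      let p : EuclideanSpace ℝ (Fin n) :=
        WithLp.toLp 2 fun i => if i ∈ A then 1 else if i ∈ S then -1 else 0
      have hpA : ∑ i ∈ A, p i = k + 1 := by
        rw [Finset.sum_congr rfl (g := fun _ => (1 : ℝ)) fun i hi => by simp [p, hi]]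
        simp [hA]
      have hpB : ∑ i ∈ S \ A, p i = -k := by
        rw [Finset.sum_congr rfl (g := fun _ => (-1 : ℝ)) fun i hi => by
          rw [Finset.mem_sdiff] at hi
          simp [p, hi]]
        simp [hB]
      have hp : p ∈ facetGauge S := by
        intro o
        rcases o with _ | i
        · rw [inner_facetNormal_none, hsplit, hpA, hpB]
          constructor <;> linarith
        · rw [inner_facetNormal_some]
          by_cases hi : i ∈ A
          · simp [p, hi]
          · by_cases hi' : i ∈ S <;> simp [p, hi, hi']
      have h := inner_le_supportFun (u := u) hC.isCompact.isBounded hp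
      rwa [hu, hpA] at h
    have hKu : supportFun (extremalBody S s - extremalBody S s) u ≤ 2 * (k + 1) := by
      have hlow : ∀ x ∈ extremalBody S s, ∀ i ∈ S, -1 ≤ x i := fun x hx i hi => by
        have h := (hx (some i)).1
        rw [inner_facetNormal_some] at h
        simpa [lowerDist, hi] using h
      refine supportFun_le (hK.nonempty.sub hK.nonempty) ?_
      rintro _ ⟨x, hx, y, hy, rfl⟩
      rw [inner_sub_right, hu, hu]
      -- From `∑_S x ≤ 1` and `x_i ≥ -1` on the `k` indices of `S \ A`, `∑_A x ≤ k + 1`; also `∑_A y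
      -- ≥ -(k + 1)`.
      have h1 : -1 ≤ -∑ i ∈ S, x i := by
        rw [← inner_facetNormal_none]
        exact (hx none).1
      have h2 : ∑ i ∈ S \ A, (-1 : ℝ) ≤ ∑ i ∈ S \ A, x i :=
        Finset.sum_le_sum fun i hi => hlow x hx i (Finset.mem_sdiff.1 hi).1
      have h3 : ∑ i ∈ A, (-1 : ℝ) ≤ ∑ i ∈ A, y i :=
        Finset.sum_le_sum fun i hi => hlow y hy i (hAS hi)
      rw [hsplit] at h1
      simp only [Finset.sum_const, hB, hA, nsmul_eq_mul, Nat.cast_add, Nat.cast_one] at h2 h3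
      linarith
    have hu0 : u ≠ 0 := by
      intro h0
      obtain ⟨c, -, hc⟩ := hC.isCompact.exists_inner_eq_supportFun hC.nonempty u
      rw [← hc, h0, inner_zero_left] at hCu
      linarith
    refine (ciInf_le (bddBelow_breadth hC hb hK.nonempty) ⟨u, hu0⟩).trans ?_
    simp only [breadth]
    rw [div_le_iff₀ (hC.supportFun_pos hu0)]
    linarith
  · have h : (1 : ℝ) • facetGauge S ⊆ extremalBody S s + {0} := by
      simpa using facetGauge_subset_extremalBody hs
    simpa using le_bodyWidth_of_smul_subset hn hb hC h

theorem exists_complete_bodyDiam_div_bodyWidth_eq (hn : 1 ≤ n) (hS : Odd S.card) (hs : 1 ≤ s)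
    (hsS : s ≤ S.card) :
    ∃ K C : Set (EuclideanSpace ℝ (Fin n)), IsBody K ∧ IsGaugeBody C ∧ IsDiamComplete K C ∧
      minkowskiAsymmetry K = s ∧ bodyDiam K C / bodyWidth K C = (s + 1) / 2 := by
  have hne : S.Nonempty := Finset.card_pos.1 hS.pos
  refine ⟨extremalBody S s, facetGauge S, isBody_extremalBody hs, isGaugeBody_facetGauge,
    isDiamComplete_extremalBody hn hne hs hsS, ?_, ?_⟩
  · exact le_antisymm (minkowskiAsymmetry_extremalBody_le hs)
      (le_minkowskiAsymmetry_extremalBody hne hs hsS)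
  · rw [bodyDiam_extremalBody hn hne hs hsS, bodyWidth_extremalBody hn hS hs]

end Construction

theorem theorem1p3 (n : ℕ) (hn : 1 ≤ n) :
    (∀ K C : Set (EuclideanSpace ℝ (Fin n)), IsBody K → IsGaugeBody C → IsPseudoComplete K C →
      bodyDiam K C / bodyWidth K C ≤ (minkowskiAsymmetry K + 1) / 2) ∧
    (2 < n → Odd n → ∀ s : ℝ, s ∈ Set.Icc (1 : ℝ) (n : ℝ) →
      ∃ K C : Set (EuclideanSpace ℝ (Fin n)), IsBody K ∧ IsGaugeBody C ∧ IsDiamComplete K C ∧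
        minkowskiAsymmetry K = s ∧ bodyDiam K C / bodyWidth K C = (s + 1) / 2) ∧
    (2 < n → Even n → ∀ s : ℝ, s ∈ Set.Icc (1 : ℝ) ((n : ℝ) - 1) →
      ∃ K C : Set (EuclideanSpace ℝ (Fin n)), IsBody K ∧ IsGaugeBody C ∧ IsDiamComplete K C ∧
        minkowskiAsymmetry K = s ∧ bodyDiam K C / bodyWidth K C = (s + 1) / 2) := by
  refine ⟨fun K C hK hC h => bodyDiam_div_bodyWidth_le hn hK hC h, fun _ hodd s hs => ?_,
    fun hn2 heven s hs => ?_⟩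
  · exact exists_complete_bodyDiam_div_bodyWidth_eq (S := Finset.univ) hn (by simpa using hodd)
      hs.1 (by simpa using hs.2)
  -- For even `n`, one coordinate is left to the cube factor so that `|S| = n - 1` is odd.
  · have hcard : (Finset.univ.erase (⟨0, hn⟩ : Fin n)).card = n - 1 := by simp
    refine exists_complete_bodyDiam_div_bodyWidth_eq (S := Finset.univ.erase ⟨0, hn⟩) hn ?_ hs.1 ?_
    · rw [hcard]
      exact Nat.Even.sub_odd hn heven odd_one
    · rw [hcard, Nat.cast_sub hn, Nat.cast_one]
      exact hs.2
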